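/- Let $G$ be a finite connected simple graph with maximum degree $\Delta(G)\le 6$ and clique number $\omega(G)\le 5$. Then there exists an independent set $I\subseteq V(G)$ that meets every induced copy of $K_5$ in $G$ and every induced copy of $C_5\boxtimes K_2$ in $G$; that is, $I\cap S\ne\emptyset$ for every $S\subseteq V(G)$ such that the subgraph of $G$ induced on $S$ is isomorphic to $K_5$ or to $C_5\boxtimes K_2$. Here $C_5\boxtimes K_2$ is the strong product of the $5$-cycle and $K_2$, where in $G_1\boxtimes G_2$ two vertices $(a,x)$ and $(b,y)$ are adjacent if and only if ($a=b$ and $xy\in E(G_2)$) or ($ab\in E(G_1)$ and $x=y$) or ($ab\in E(G_1)$ and $xy\in E(G_2)$). -/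

import Mathlib

/-- The strong product of two simple graphs: `(a, x)` and `(b, y)` are adjacent iff
`a = b` and `x`, `y` are adjacent, or `a`, `b` are adjacent and `x = y`, or both pairs are
adjacent. -/
def strongProduct {α β : Type*} (G : SimpleGraph α) (H : SimpleGraph β) :
    SimpleGraph (α × β) where
  Adj p q := (p.1 = q.1 ∧ H.Adj p.2 q.2) ∨ (G.Adj p.1 q.1 ∧ p.2 = q.2) ∨
    (G.Adj p.1 q.1 ∧ H.Adj p.2 q.2)
  symm := ⟨by
    rintro p q (⟨h, h'⟩ | ⟨h, h'⟩ | ⟨h, h'⟩)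
    · exact Or.inl ⟨h.symm, h'.symm⟩
    · exact Or.inr (Or.inl ⟨h.symm, h'.symm⟩)
    · exact Or.inr (Or.inr ⟨h.symm, h'.symm⟩)⟩
  loopless := ⟨by
    rintro p (⟨_, h⟩ | ⟨h, _⟩ | ⟨h, _⟩)
    · exact H.irrefl h
    · exact G.irrefl h
    · exact G.irrefl h⟩

/-- The vertex set `I` meets every induced copy of `F` in `G`, that is, every vertex set `S`
such that the subgraph of `G` induced on `S` is isomorphic to `F`. -/
def MeetsInducedCopies {V W : Type*} (G : SimpleGraph V) (F : SimpleGraph W) (I : Set V) : Prop :=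
  ∀ S : Set V, Nonempty (G.induce S ≃g F) → (I ∩ S).Nonempty

/-! Call 5-cliques and vertex sets of induced copies of `C5K2` obstructions. A vertex has at least 4
neighbours inside any obstruction containing it and at most 6 in all, so intersecting obstructions
overlap heavily.

Induct on the family `F` of obstructions to be hit. If some independent set `J` hits a member of `F`
and has no neighbour in the members it misses (`IsFree`), those members can be hit separately and
`J` added. Such a `J` exists whenever a clique meets a copy, two distinct copies meet, or two
cliques share exactly three vertices (`exists_isFree_of_clique_meets_copy`,
`exists_isFree_of_copies_meet`, `exists_isFree_of_cliques_meet`).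

Otherwise meeting is an equivalence relation on `F`, and the members of each class have at least 4
common vertices. Such a common vertex has at most 6 - 4 = 2 neighbours in the cores of other
classes, so Haxell's theorem with `d = 2` picks pairwise non-adjacent vertices, one per core
(`exists_hitting_of_separated`). -/

/-! ### Independent transversals. -/

/-- `t` picks from every class `P i`, `i ∈ s`, a vertex, and the picked vertices are pairwise
non-adjacent. -/
def IsTransversal {V ι : Type*} (G : SimpleGraph V) (s : Finset ι) (P : ι → Set V)
    (t : ι → V) : Prop :=
  (∀ i ∈ s, t i ∈ P i) ∧ ∀ i ∈ s, ∀ j ∈ s, ¬ G.Adj (t i) (t j)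

/-- If the classes indexed by `s` have no independent transversal but those other than `P o` have
one, then there is a set of classes containing `P o` whose union is dominated by few vertices. -/
theorem exists_dominating_of_no_transversal {V ι : Type*} [Finite V] [DecidableEq ι] :
    ∀ (n : ℕ) (G : SimpleGraph V) (s : Finset ι) (P : ι → Set V) (o : ι),
      s.card = n → o ∈ s →
      (∀ i ∈ s, ∀ j ∈ s, i ≠ j → Disjoint (P i) (P j)) →
      (¬ ∃ t, IsTransversal G s P t) → (∃ t, IsTransversal G (s.erase o) P t) →
      ∃ (S : Finset ι) (Z : Finset V), S ⊆ s ∧ o ∈ S ∧ Z.card + 2 ≤ 2 * S.card ∧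
        ∀ i ∈ S, ∀ v ∈ P i, ∃ z ∈ Z, G.Adj z v := by
  classical
  intro n
  induction n with
  | zero =>
    intro G s P o hs ho
    rw [Finset.card_eq_zero] at hs
    simp [hs] at ho
  | succ n ih =>
    intro G s P o hs ho hdisj hno hyes
    -- Edge-minimality makes every edge critical: deleting it creates a transversal, which must use
    -- both its ends.
    obtain ⟨G₀, hG₀, hmin⟩ : ∃ G₀ : SimpleGraph V, (G₀ ≤ G ∧ ¬ ∃ t, IsTransversal G₀ s P t) ∧
        ∀ H : SimpleGraph V, H < G₀ → ∃ t, IsTransversal H s P t := by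
      obtain ⟨G₀, h₀⟩ := (Set.toFinite {H : SimpleGraph V | H ≤ G ∧
        ¬ ∃ t, IsTransversal H s P t}).exists_minimal ⟨G, le_rfl, hno⟩
      refine ⟨G₀, h₀.prop, fun H hH => ?_⟩
      by_contra hc
      exact absurd (h₀.le_of_le ⟨hH.le.trans h₀.prop.1, hc⟩ hH.le) (not_le_of_gt hH)
    obtain ⟨hle, hno₀⟩ := hG₀
    by_cases hemp : P o = ∅
    -- The extremal case of the bound: 0 + 2 = 2 · 1.
    · exact ⟨{o}, ∅, by simpa using ho, by simp, by simp, by simp [hemp]⟩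
    obtain ⟨v, hv⟩ := Set.nonempty_iff_ne_empty.2 hemp
    obtain ⟨t₁, ht₁, ht₁'⟩ := hyes
    -- some chosen vertex is adjacent to `v`
    obtain ⟨j, hj, hvj⟩ : ∃ j ∈ s.erase o, G₀.Adj v (t₁ j) := by
      by_contra! hc
      refine hno₀ ⟨Function.update t₁ o v, ?_, ?_⟩
      · intro i hi
        by_cases hio : i = o
        · subst hio; simpa using hv
        · simpa [hio] using ht₁ i (Finset.mem_erase.2 ⟨hio, hi⟩)
      · intro i hi k hk
        by_cases hio : i = o <;> by_cases hko : k = o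
        · simp [hio, hko]
        · subst hio
          simpa [hko] using hc k (Finset.mem_erase.2 ⟨hko, hk⟩)
        · subst hko
          simpa [hio, G₀.adj_comm] using hc i (Finset.mem_erase.2 ⟨hio, hi⟩)
        · simpa [hio, hko] using fun h => ht₁' i (Finset.mem_erase.2 ⟨hio, hi⟩) k
            (Finset.mem_erase.2 ⟨hko, hk⟩) (hle h)
    have hjo : j ≠ o := (Finset.mem_erase.1 hj).1
    have hjs : j ∈ s := (Finset.mem_erase.1 hj).2
    set y := t₁ j with hy
    have hyP : y ∈ P j := ht₁ j hj
    -- removing the edge `v y` yields a transversal through `v` and `y`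
    obtain ⟨t, ht, ht'⟩ := hmin (G₀.deleteEdges {s(v, y)}) (by
      refine lt_of_le_of_ne (G₀.deleteEdges_le _) fun h => ?_
      have : (G₀.deleteEdges {s(v, y)}).Adj v y := by rw [h]; exact hvj
      simp at this)
    have key : ∀ i ∈ s, ∀ k ∈ s, G₀.Adj (t i) (t k) → s(t i, t k) = s(v, y) := by
      intro i hi k hk hik
      by_contra hc
      exact ht' i hi k hk (by simp only [SimpleGraph.deleteEdges_adj]; exact ⟨hik, hc⟩)
    have uniq : ∀ i ∈ s, ∀ k ∈ s, ∀ x, x ∈ P i → x ∈ P k → i = k := by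
      intro i hi k hk x hxi hxk
      by_contra hik
      exact Set.disjoint_left.1 (hdisj i hi k hk hik) hxi hxk
    have htv : t o = v ∧ t j = y := by
      have : ¬ ∀ i ∈ s, ∀ k ∈ s, ¬ G₀.Adj (t i) (t k) := fun h => hno₀ ⟨t, ht, h⟩
      push Not at this
      obtain ⟨i, hi, k, hk, hik⟩ := this
      have h := key i hi k hk hik
      rw [Sym2.eq_iff] at h
      rcases h with ⟨h1, h2⟩ | ⟨h1, h2⟩
      · have := uniq i hi o ho v (h1 ▸ ht i hi) hv
        have := uniq k hk j hjs y (h2 ▸ ht k hk) hyP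
        subst i k
        exact ⟨h1, h2⟩
      · have := uniq i hi j hjs y (h1 ▸ ht i hi) hyP
        have := uniq k hk o ho v (h2 ▸ ht k hk) hv
        subst i k
        exact ⟨h2, h1⟩
    obtain ⟨hto, htj⟩ := htv
    let N : Set V := {x | G₀.Adj v x ∨ G₀.Adj y x}
    -- Merge class `j` into `o` and discard all neighbours of `v` and `y`. A transversal of the new
    -- classes would extend to the old ones: its vertex in the merged class serves `o` or `j`, and
    -- `y` or `v` serves the other. Away from `o`, `t` still works.
    let P' : ι → Set V := fun i => if i = o then (P o ∪ P j) \ N else P i \ N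
    have hP'o : P' o = (P o ∪ P j) \ N := by simp [P']
    have hP' : ∀ i, i ≠ o → P' i = P i \ N := fun i hi => by simp [P', hi]
    obtain ⟨S', Z', hS's, hoS', hcard, hdom⟩ := ih G₀ (s.erase j) P' o
      (by rw [Finset.card_erase_of_mem hjs, hs]; rfl)
      (Finset.mem_erase.2 ⟨hjo.symm, ho⟩)
      (by
        intro i hi k hk hik
        obtain ⟨hij, hi⟩ := Finset.mem_erase.1 hi
        obtain ⟨hkj, hk⟩ := Finset.mem_erase.1 hk
        rw [Set.disjoint_left]
        intro x hxi hxk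
        by_cases hio : i = o <;> by_cases hko : k = o
        · exact hik (hio.trans hko.symm)
        · rw [hio, hP'o] at hxi
          rw [hP' k hko] at hxk
          rcases hxi.1 with h | h
          · exact hko (uniq k hk o ho x hxk.1 h)
          · exact hkj (uniq k hk j hjs x hxk.1 h)
        · rw [hko, hP'o] at hxk
          rw [hP' i hio] at hxi
          rcases hxk.1 with h | h
          · exact hio (uniq i hi o ho x hxi.1 h)
          · exact hij (uniq i hi j hjs x hxi.1 h)
        · rw [hP' i hio] at hxi
          rw [hP' k hko] at hxk
          exact hik (uniq i hi k hk x hxi.1 hxk.1))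
      (by
        rintro ⟨u, hu, hu'⟩
        have huo := hu o (Finset.mem_erase.2 ⟨hjo.symm, ho⟩)
        rw [hP'o] at huo
        have huN : ∀ i ∈ s.erase j, ¬ G₀.Adj v (u i) ∧ ¬ G₀.Adj y (u i) := by
          intro i hi
          have := hu i hi
          have : u i ∉ N := by
            by_cases hio : i = o
            · rw [hio, hP'o] at this; rw [hio]; exact this.2
            · rw [hP' i hio] at this; exact this.2
          simpa [N, not_or] using this
        have huP : ∀ i ∈ s.erase j, i ≠ o → u i ∈ P i := by
          intro i hi hio
          have := hu i hi
          rw [hP' i hio] at this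
          exact this.1
        rcases huo.1 with h | h
        · refine hno₀ ⟨Function.update u j y, ?_, ?_⟩
          · intro i hi
            by_cases hij : i = j
            · subst hij; simpa using hyP
            · by_cases hio : i = o
              · subst hio; simpa [hij] using h
              · simpa [hij] using huP i (Finset.mem_erase.2 ⟨hij, hi⟩) hio
          · intro i hi k hk
            by_cases hij : i = j <;> by_cases hkj : k = j
            · simp [hij, hkj]
            · subst hij
              simpa [hkj] using (huN k (Finset.mem_erase.2 ⟨hkj, hk⟩)).2
            · subst hkj
              simpa [hij, G₀.adj_comm] using (huN i (Finset.mem_erase.2 ⟨hij, hi⟩)).2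
            · simpa [hij, hkj] using hu' i (Finset.mem_erase.2 ⟨hij, hi⟩) k
                (Finset.mem_erase.2 ⟨hkj, hk⟩)
        · refine hno₀ ⟨fun i => if i = j then u o else if i = o then v else u i, ?_, ?_⟩
          · intro i hi
            by_cases hij : i = j
            · subst hij; simpa using h
            · by_cases hio : i = o
              · subst hio; simpa [hij] using hv
              · simpa [hij, hio] using huP i (Finset.mem_erase.2 ⟨hij, hi⟩) hio
          · have ho' : o ∈ s.erase j := Finset.mem_erase.2 ⟨hjo.symm, ho⟩
            have aux : ∀ i ∈ s, (if i = j then u o else if i = o then v else u i) = v ∨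
                ∃ k ∈ s.erase j, (if i = j then u o else if i = o then v else u i) = u k := by
              intro i hi
              by_cases hij : i = j
              · exact Or.inr ⟨o, ho', by simp [hij]⟩
              · by_cases hio : i = o
                · left; simp [hio, hjo.symm]
                · exact Or.inr ⟨i, Finset.mem_erase.2 ⟨hij, hi⟩, by simp [hij, hio]⟩
            intro i hi k hk
            show ¬ G₀.Adj (if i = j then u o else if i = o then v else u i)
              (if k = j then u o else if k = o then v else u k)
            rcases aux i hi with h1 | ⟨a, ha, h1⟩ <;> rcases aux k hk with h2 | ⟨b, hb, h2⟩ <;>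
              rw [h1, h2]
            · simp
            · exact (huN b hb).1
            · rw [G₀.adj_comm]; exact (huN a ha).1
            · exact hu' a ha b hb)
      (by
        refine ⟨t, ?_, ?_⟩
        · intro i hi
          obtain ⟨hio, hi⟩ := Finset.mem_erase.1 hi
          obtain ⟨hij, hi⟩ := Finset.mem_erase.1 hi
          rw [hP' i hio]
          refine ⟨ht i hi, ?_⟩
          rintro (h | h)
          · have := key o ho i hi (by rwa [hto])
            rw [hto, Sym2.eq_iff] at this
            rcases this with ⟨-, h2⟩ | ⟨h1, h2⟩
            · exact hij (uniq i hi j hjs y (h2 ▸ ht i hi) hyP)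
            · exact hvj.ne h1
          · have := key j hjs i hi (by rwa [htj])
            rw [htj, Sym2.eq_iff] at this
            rcases this with ⟨h1, h2⟩ | ⟨-, h2⟩
            · exact hvj.ne h1.symm
            · exact hio (uniq i hi o ho v (h2 ▸ ht i hi) hv)
        · intro i hi k hk hik
          obtain ⟨hio, hi⟩ := Finset.mem_erase.1 hi
          obtain ⟨hij, hi⟩ := Finset.mem_erase.1 hi
          obtain ⟨hko, hk⟩ := Finset.mem_erase.1 hk
          obtain ⟨hkj, hk⟩ := Finset.mem_erase.1 hk
          have := key i hi k hk hik
          rw [Sym2.eq_iff] at this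
          rcases this with ⟨h1, -⟩ | ⟨h1, -⟩
          · exact hio (uniq i hi o ho v (h1 ▸ ht i hi) hv)
          · exact hij (uniq i hi j hjs y (h1 ▸ ht i hi) hyP))
    have hjS' : j ∉ S' := fun h => (Finset.mem_erase.1 (hS's h)).1 rfl
    refine ⟨insert j S', insert v (insert y Z'), ?_, Finset.mem_insert_of_mem hoS', ?_, ?_⟩
    · intro i hi
      rcases Finset.mem_insert.1 hi with h | h
      · exact h ▸ hjs
      · exact (Finset.mem_erase.1 (hS's h)).2
    · rw [Finset.card_insert_of_notMem hjS']
      have h1 := Finset.card_insert_le v (insert y Z')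
      have h2 := Finset.card_insert_le y Z'
      omega
    · intro i hi x hx
      by_cases hxN : x ∈ N
      · rcases hxN with h | h
        · exact ⟨v, by simp, hle h⟩
        · exact ⟨y, by simp, hle h⟩
      · have : ∃ k ∈ S', x ∈ P' k := by
          by_cases hio : i = o
          · exact ⟨o, hoS', by rw [hP'o]; exact ⟨Or.inl (hio ▸ hx), hxN⟩⟩
          · rcases Finset.mem_insert.1 hi with h | h
            · exact ⟨o, hoS', by rw [hP'o]; exact ⟨Or.inr (h ▸ hx), hxN⟩⟩
            · exact ⟨i, h, by rw [hP' i hio]; exact ⟨hx, hxN⟩⟩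
        obtain ⟨k, hk, hxk⟩ := this
        obtain ⟨z, hz, hzx⟩ := hdom k hk x hxk
        exact ⟨z, by simp [hz], hle hzx⟩

/-- **Haxell's theorem**: disjoint classes of size at least `2 * d` in a graph of maximum degree at
most `d`, `d > 0`, have an independent transversal. -/
theorem exists_transversal {V ι : Type*} [Fintype V] [Nonempty V] [DecidableEq ι] (G : SimpleGraph V)
    [DecidableRel G.Adj] {d : ℕ} (hd : 0 < d) (hdeg : ∀ v, G.degree v ≤ d) (P : ι → Finset V)
    (s : Finset ι) (hdisj : ∀ i ∈ s, ∀ j ∈ s, i ≠ j → Disjoint (P i) (P j))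
    (hcard : ∀ i ∈ s, 2 * d ≤ (P i).card) :
    ∃ t, IsTransversal G s (fun i => (P i : Set V)) t := by
  classical
  induction s using Finset.induction_on with
  | empty =>
    exact ⟨fun _ => Classical.arbitrary V, by simp [IsTransversal]⟩
  | insert o s ho ih =>
    by_contra hno
    obtain ⟨S, Z, hS, hoS, hZ, hdom⟩ := exists_dominating_of_no_transversal _ G (insert o s)
      (fun i => (P i : Set V)) o rfl (by simp)
      (fun i hi j hj hij => by simpa using hdisj i hi j hj hij) hno (by
        rw [Finset.erase_insert ho]
        exact ih (fun i hi j hj => hdisj i (by simp [hi]) j (by simp [hj]))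
          (fun i hi => hcard i (by simp [hi])))
    have h1 : 2 * d * S.card ≤ (S.biUnion P).card := by
      rw [Finset.card_biUnion fun i hi j hj hij => hdisj i (hS hi) j (hS hj) hij, mul_comm,
        ← smul_eq_mul]
      exact Finset.card_nsmul_le_sum _ _ _ fun i hi => hcard i (hS hi)
    have h2 : S.biUnion P ⊆ Z.biUnion fun z => G.neighborFinset z := by
      intro v hv
      obtain ⟨i, hi, hvi⟩ := Finset.mem_biUnion.1 hv
      obtain ⟨z, hz, hzv⟩ := hdom i hi v (by simpa using hvi)
      exact Finset.mem_biUnion.2 ⟨z, hz, by simpa using hzv⟩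
    have h3 : (Z.biUnion fun z => G.neighborFinset z).card ≤ Z.card * d :=
      Finset.card_biUnion_le_card_mul _ _ _ fun z _ => by simpa using hdeg z
    have h4 := (h1.trans (Finset.card_le_card h2)).trans h3
    have h5 : (Z.card + 2) * d ≤ 2 * S.card * d := Nat.mul_le_mul_right d hZ
    -- 2d|S| ≤ |⋃ P i| ≤ d|Z| ≤ d(2|S| - 2) is absurd for d > 0.
    nlinarith

/-! ### The graph `C5K2`. -/

/-- The strong product of the five-cycle and the complete graph on two vertices. -/
abbrev C5K2 : SimpleGraph (Fin 5 × Fin 2) :=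
  strongProduct (SimpleGraph.cycleGraph 5) (SimpleGraph.completeGraph (Fin 2))

theorem C5K2_adj : ∀ p q : Fin 5 × Fin 2,
    C5K2.Adj p q ↔ p ≠ q ∧ (p.1 = q.1 ∨ p.1 + 1 = q.1 ∨ q.1 + 1 = p.1) := by
  have : ∀ p q : Fin 5 × Fin 2, ((p.1 = q.1 ∧ p.2 ≠ q.2) ∨
      ((SimpleGraph.cycleGraph 5).Adj p.1 q.1 ∧ p.2 = q.2) ∨
      ((SimpleGraph.cycleGraph 5).Adj p.1 q.1 ∧ p.2 ≠ q.2)) ↔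
      p ≠ q ∧ (p.1 = q.1 ∨ p.1 + 1 = q.1 ∨ q.1 + 1 = p.1) := by
    decide
  exact this

instance : DecidableRel C5K2.Adj := fun p q => decidable_of_iff _ (C5K2_adj p q).symm

theorem C5K2_degree : ∀ p, C5K2.degree p = 5 := by decide

/-- A clique with at least four vertices consists of two consecutive columns. -/
theorem C5K2_clique {Q : Finset (Fin 5 × Fin 2)} (hQ : C5K2.IsClique (Q : Set _))
    (hcard : 4 ≤ Q.card) : ∃ i : Fin 5, ∀ p, p ∈ Q ↔ p.1 = i ∨ p.1 = i + 1 := by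
  have h1 : ∀ C : Finset (Fin 5), (∀ a ∈ C, ∀ b ∈ C, a = b ∨ a + 1 = b ∨ b + 1 = a) →
      ∃ i, ∀ a ∈ C, a = i ∨ a = i + 1 := by decide
  obtain ⟨i, hi⟩ := h1 (Q.image Prod.fst) (by
    intro a ha b hb
    obtain ⟨p, hp, rfl⟩ := Finset.mem_image.1 ha
    obtain ⟨q, hq, rfl⟩ := Finset.mem_image.1 hb
    by_cases hpq : p = q
    · exact Or.inl (by rw [hpq])
    · exact ((C5K2_adj p q).1 (hQ hp hq hpq)).2)
  have h2 : ∀ i : Fin 5, (Finset.univ.filter fun p : Fin 5 × Fin 2 =>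
      p.1 = i ∨ p.1 = i + 1).card = 4 := by decide
  have h3 : Q = Finset.univ.filter fun p : Fin 5 × Fin 2 => p.1 = i ∨ p.1 = i + 1 :=
    Finset.eq_of_subset_of_card_le
      (fun p hp => by simpa using hi p.1 (Finset.mem_image_of_mem _ hp)) (by rw [h2]; exact hcard)
  exact ⟨i, fun p => by rw [h3]; simp⟩

/-- A nonempty vertex set each of whose members has at most one neighbour outside of it misses at
most one vertex. -/
theorem C5K2_missing_unique {R : Fin 5 × Fin 2 → Prop} {p₀ : Fin 5 × Fin 2} (hp₀ : R p₀)
    (hR : ∀ p q q', R p → C5K2.Adj p q → C5K2.Adj p q' → ¬ R q → ¬ R q' → q = q')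
    {q q' : Fin 5 × Fin 2} (hq : ¬ R q) (hq' : ¬ R q') : q = q' := by
  by_contra hne
  -- A fully missing column already gives each vertex of the next column two missing neighbours, so
  -- emptiness spreads around the cycle.
  have step : ∀ a : Fin 5, (∀ r, r.1 = a → ¬ R r) → ∀ r, r.1 = a + 1 → ¬ R r := by
    intro a ha r hr hRr
    have h : ∀ r : Fin 5 × Fin 2, ∀ a, r.1 = a + 1 →
        C5K2.Adj r (a, 0) ∧ C5K2.Adj r (a, 1) := by decide
    have := hR r _ _ hRr (h r a hr).1 (h r a hr).2 (ha _ rfl) (ha _ rfl)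
    simp at this
  -- Any two vertices have a column whose vertices are each one of the two or adjacent to both.
  obtain ⟨a, ha⟩ : ∃ a : Fin 5, ∀ r, r.1 = a → ¬ R r := by
    have h : ∀ q q' : Fin 5 × Fin 2, q ≠ q' → ∃ a : Fin 5, ∀ r : Fin 5 × Fin 2, r.1 = a →
        r = q ∨ r = q' ∨ (C5K2.Adj r q ∧ C5K2.Adj r q') := by decide
    obtain ⟨a, ha⟩ := h q q' hne
    refine ⟨a, fun r hr hRr => ?_⟩
    rcases ha r hr with rfl | rfl | ⟨h1, h2⟩
    · exact hq hRr
    · exact hq' hRr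
    · exact hne (hR r q q' hRr h1 h2 hq hq')
  have s1 := step _ ha
  have s2 := step _ s1
  have s3 := step _ s2
  have s4 := step _ s3
  have h : ∀ x a : Fin 5, x = a ∨ x = a + 1 ∨ x = a + 1 + 1 ∨ x = a + 1 + 1 + 1 ∨
      x = a + 1 + 1 + 1 + 1 := by decide
  rcases h p₀.1 a with h | h | h | h | h
  exacts [ha _ h hp₀, s1 _ h hp₀, s2 _ h hp₀, s3 _ h hp₀, s4 _ h hp₀]

set_option linter.unusedSectionVars false

/-! ### How two obstructions can intersect. -/

section LocalStructure

variable {V : Type*} [Fintype V] [DecidableEq V] {G : SimpleGraph V} [DecidableRel G.Adj]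

/-- The vertex set of an induced copy of `C5K2`. -/
def copyVerts (e : C5K2 ↪g G) : Finset V := Finset.univ.map e.toEmbedding

theorem mem_copyVerts {e : C5K2 ↪g G} {v : V} : v ∈ copyVerts e ↔ ∃ p, e p = v := by
  simp [copyVerts]

theorem apply_mem_copyVerts (e : C5K2 ↪g G) (p : Fin 5 × Fin 2) : e p ∈ copyVerts e :=
  mem_copyVerts.2 ⟨p, rfl⟩

theorem card_copyVerts (e : C5K2 ↪g G) : (copyVerts e).card = 10 := by
  simp [copyVerts]

theorem card_filter_adj_copyVerts (e : C5K2 ↪g G) (p : Fin 5 × Fin 2) :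
    ((copyVerts e).filter (G.Adj (e p))).card = 5 := by
  have : (copyVerts e).filter (G.Adj (e p)) = (C5K2.neighborFinset p).map e.toEmbedding := by
    ext v
    simp only [Finset.mem_filter, mem_copyVerts, Finset.mem_map, SimpleGraph.mem_neighborFinset]
    constructor
    · rintro ⟨⟨q, rfl⟩, h⟩
      exact ⟨q, e.map_adj_iff.1 h, rfl⟩
    · rintro ⟨q, h, rfl⟩
      exact ⟨⟨q, rfl⟩, e.map_adj_iff.2 h⟩
  rw [this, Finset.card_map, SimpleGraph.card_neighborFinset_eq_degree, C5K2_degree]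

theorem card_filter_adj_clique {n : ℕ} {A : Finset V} (hA : G.IsNClique n A) {v : V}
    (hv : v ∈ A) : (A.filter (G.Adj v)).card + 1 = n := by
  have : A.filter (G.Adj v) = A.erase v := by
    ext u
    simp only [Finset.mem_filter, Finset.mem_erase]
    exact ⟨fun h => ⟨h.2.ne', h.1⟩, fun h => ⟨h.2, hA.1 hv h.2 h.1.symm⟩⟩
  rw [this, Finset.card_erase_add_one hv, hA.2]

theorem card_filter_adj_le (hdeg : ∀ v, G.degree v ≤ 6) (v : V) (X : Finset V) :
    (X.filter (G.Adj v)).card ≤ 6 := by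
  refine le_trans (Finset.card_le_card fun u hu => ?_)
    ((G.card_neighborFinset_eq_degree v).trans_le (hdeg v))
  simpa using (Finset.mem_filter.1 hu).2

/-- Inclusion–exclusion on the neighbours of `v`; the source of all the overlap bounds. -/
theorem card_filter_adj_inter (hdeg : ∀ v, G.degree v ≤ 6) (v : V) (X Y : Finset V) :
    (X.filter (G.Adj v)).card + (Y.filter (G.Adj v)).card ≤
      ((X ∩ Y).filter (G.Adj v)).card + 6 := by
  have h1 := card_filter_adj_le hdeg v (X ∪ Y)
  have h2 := Finset.card_union_add_card_inter (X.filter (G.Adj v)) (Y.filter (G.Adj v))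
  rw [← Finset.filter_union, ← Finset.filter_inter_distrib] at h2
  omega

theorem card_filter_adj_lt {v : V} {X : Finset V} (hv : v ∈ X) :
    (X.filter (G.Adj v)).card + 1 ≤ X.card := by
  have : X.filter (G.Adj v) ⊆ X.erase v := fun u hu => by
    have := Finset.mem_filter.1 hu
    exact Finset.mem_erase.2 ⟨this.2.ne', this.1⟩
  rw [← Finset.card_erase_add_one hv]
  exact Nat.succ_le_succ (Finset.card_le_card this)

/-- Two intersecting 5-cliques share at least three vertices. -/
theorem three_le_card_inter_cliques (hdeg : ∀ v, G.degree v ≤ 6) {A B : Finset V}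
    (hA : G.IsNClique 5 A) (hB : G.IsNClique 5 B) (h : (A ∩ B).Nonempty) :
    3 ≤ (A ∩ B).card := by
  obtain ⟨v, hv⟩ := h
  have h1 := card_filter_adj_clique hA (Finset.mem_inter.1 hv).1
  have h2 := card_filter_adj_clique hB (Finset.mem_inter.1 hv).2
  have h3 := card_filter_adj_inter hdeg v A B
  have h4 := card_filter_adj_lt (G := G) hv
  omega

/-- A vertex of a copy has at most one neighbour outside of the copy. -/
theorem outside_neighbor_unique (hdeg : ∀ v, G.degree v ≤ 6) (e : C5K2 ↪g G)
    {p : Fin 5 × Fin 2} {w w' : V} (hw : w ∉ copyVerts e) (hw' : w' ∉ copyVerts e)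
    (h : G.Adj (e p) w) (h' : G.Adj (e p) w') : w = w' := by
  by_contra hne
  have h1 := card_filter_adj_le hdeg (e p) (insert w (insert w' (copyVerts e)))
  rw [Finset.filter_insert, if_pos h, Finset.filter_insert, if_pos h',
    Finset.card_insert_of_notMem (by simp [hne, hw]), Finset.card_insert_of_notMem (by simp [hw']),
    card_filter_adj_copyVerts] at h1
  omega

theorem card_le_of_adj_copy (hdeg : ∀ v, G.degree v ≤ 6) (e : C5K2 ↪g G) {w : V}
    (Q : Finset (Fin 5 × Fin 2)) (h : ∀ p ∈ Q, G.Adj (e p) w) : Q.card ≤ 6 := by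
  have h1 := card_filter_adj_le hdeg w (Q.map e.toEmbedding)
  rw [Finset.filter_true_of_mem, Finset.card_map] at h1
  · exact h1
  · intro x hx
    obtain ⟨p, hp, rfl⟩ := Finset.mem_map.1 hx
    exact (h p hp).symm

/-- A 5-clique meeting a copy consists of two consecutive columns and one further vertex. -/
theorem clique_meets_copy (hdeg : ∀ v, G.degree v ≤ 6) (e : C5K2 ↪g G) {A : Finset V}
    (hA : G.IsNClique 5 A) (h : (A ∩ copyVerts e).Nonempty) :
    4 ≤ (A ∩ copyVerts e).card ∧ ∃ (i : Fin 5) (w : V), w ∈ A ∧ w ∉ copyVerts e ∧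
      (∀ p, e p ∈ A ↔ p.1 = i ∨ p.1 = i + 1) ∧ (∀ p, p.1 = i ∨ p.1 = i + 1 → G.Adj (e p) w) ∧
      ∀ x ∈ A, x ∉ copyVerts e → x = w := by
  -- A common vertex has at least 4 + 5 - 6 = 3 neighbours in the intersection, and itself makes
  -- four.
  have h4 : 4 ≤ (A ∩ copyVerts e).card := by
    obtain ⟨v, hv⟩ := h
    have h1 := card_filter_adj_clique hA (Finset.mem_inter.1 hv).1
    obtain ⟨p, rfl⟩ := mem_copyVerts.1 (Finset.mem_inter.1 hv).2
    have h2 := card_filter_adj_copyVerts e p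
    have h3 := card_filter_adj_inter hdeg (e p) A (copyVerts e)
    have h4 := card_filter_adj_lt (G := G) hv
    omega
  refine ⟨h4, ?_⟩
  let Q := Finset.univ.filter fun p => e p ∈ A
  have hQ : Q.map e.toEmbedding = A ∩ copyVerts e := by
    ext x
    simp only [Q, Finset.mem_map, Finset.mem_filter, Finset.mem_univ, true_and,
      Finset.mem_inter, mem_copyVerts]
    constructor
    · rintro ⟨p, hp, rfl⟩; exact ⟨hp, p, rfl⟩
    · rintro ⟨hx, p, rfl⟩; exact ⟨p, hx, rfl⟩
  have hQc : Q.card = (A ∩ copyVerts e).card := by rw [← hQ, Finset.card_map]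
  obtain ⟨i, hi⟩ := C5K2_clique (Q := Q) (by
    intro p hp q hq hpq
    exact e.map_adj_iff.1 (hA.1 (by simpa [Q] using hp) (by simpa [Q] using hq)
      (e.injective.ne hpq))) (hQc ▸ h4)
  have hQ4 : Q.card = 4 := by
    have h2 : ∀ i : Fin 5, (Finset.univ.filter fun p : Fin 5 × Fin 2 =>
      p.1 = i ∨ p.1 = i + 1).card = 4 := by decide
    rw [← h2 i]
    congr 1
    ext p
    simpa using hi p
  have h5 : (A \ copyVerts e).card = 1 := by
    have := Finset.card_sdiff_add_card_inter A (copyVerts e)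
    rw [hA.2] at this
    omega
  obtain ⟨w, hw⟩ := Finset.card_eq_one.1 h5
  have hwA : w ∈ A \ copyVerts e := by simp [hw]
  obtain ⟨hwA, hwS⟩ := Finset.mem_sdiff.1 hwA
  have hi' : ∀ p, e p ∈ A ↔ p.1 = i ∨ p.1 = i + 1 := fun p => by simpa [Q] using hi p
  refine ⟨i, w, hwA, hwS, hi', fun p hp => hA.1 ((hi' p).2 hp) hwA ?_, fun x hx hxS => ?_⟩
  · rintro rfl; exact hwS (apply_mem_copyVerts e p)
  · have : x ∈ A \ copyVerts e := Finset.mem_sdiff.2 ⟨hx, hxS⟩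
    simpa [hw] using this

/-- A copy meeting another copy misses at most one of its vertices. -/
theorem copy_missing_unique (hdeg : ∀ v, G.degree v ≤ 6) (e f : C5K2 ↪g G)
    (h : (copyVerts e ∩ copyVerts f).Nonempty) {q q' : Fin 5 × Fin 2}
    (hq : e q ∉ copyVerts f) (hq' : e q' ∉ copyVerts f) : q = q' := by
  obtain ⟨v, hv⟩ := h
  obtain ⟨hvS, hvT⟩ := Finset.mem_inter.1 hv
  obtain ⟨p₀, rfl⟩ := mem_copyVerts.1 hvS
  refine C5K2_missing_unique (R := fun p => e p ∈ copyVerts f) hvT ?_ hq hq'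
  intro p r r' hp hr hr' hrT hrT'
  by_contra hne
  obtain ⟨p', hp'⟩ := mem_copyVerts.1 hp
  have h1 := card_filter_adj_copyVerts e p
  have h2 := card_filter_adj_copyVerts f p'
  rw [hp'] at h2
  have h3 := card_filter_adj_inter hdeg (e p) (copyVerts e) (copyVerts f)
  -- At least 5 + 5 - 6 = 4 neighbours of `e p` are common to both copies; two missing ones would
  -- leave only three.
  have h4 : (copyVerts e ∩ copyVerts f).filter (G.Adj (e p)) ⊆
      (((copyVerts e).filter (G.Adj (e p))).erase (e r)).erase (e r') := by
    intro x hx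
    obtain ⟨hx, hpx⟩ := Finset.mem_filter.1 hx
    obtain ⟨hxS, hxT⟩ := Finset.mem_inter.1 hx
    refine Finset.mem_erase.2 ⟨?_, Finset.mem_erase.2 ⟨?_, Finset.mem_filter.2 ⟨hxS, hpx⟩⟩⟩
    · rintro rfl; exact hrT' hxT
    · rintro rfl; exact hrT hxT
  have h5 := Finset.card_le_card h4
  rw [Finset.card_erase_of_mem, Finset.card_erase_of_mem, h1] at h5
  · omega
  · exact Finset.mem_filter.2 ⟨apply_mem_copyVerts e r, e.map_adj_iff.2 hr⟩
  · exact Finset.mem_erase.2 ⟨e.injective.ne (Ne.symm hne),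
      Finset.mem_filter.2 ⟨apply_mem_copyVerts e r', e.map_adj_iff.2 hr'⟩⟩

/-- A copy meeting a given copy arises from it by replacing a vertex by a twin. -/
theorem copy_meets_copy (hdeg : ∀ v, G.degree v ≤ 6) (e f : C5K2 ↪g G)
    (h : (copyVerts e ∩ copyVerts f).Nonempty) {v : Fin 5 × Fin 2} (hv : e v ∉ copyVerts f) :
    ∃ w, w ∈ copyVerts f ∧ w ∉ copyVerts e ∧ (∀ x ∈ copyVerts f, x ∉ copyVerts e → x = w) ∧
      ∀ q, C5K2.Adj v q → G.Adj (e q) w := by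
  have h1 : copyVerts e \ copyVerts f = {e v} := by
    ext x
    simp only [Finset.mem_sdiff, Finset.mem_singleton]
    constructor
    · rintro ⟨hx, hxf⟩
      obtain ⟨q, rfl⟩ := mem_copyVerts.1 hx
      rw [copy_missing_unique hdeg e f h hxf hv]
    · rintro rfl
      exact ⟨apply_mem_copyVerts e v, hv⟩
  have h2 : (copyVerts f \ copyVerts e).card = 1 := by
    rw [Finset.card_sdiff_comm ((card_copyVerts f).trans (card_copyVerts e).symm), h1]
    simp
  obtain ⟨w, hw⟩ := Finset.card_eq_one.1 h2
  have hwf : w ∈ copyVerts f \ copyVerts e := by simp [hw]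
  obtain ⟨hwf, hwe⟩ := Finset.mem_sdiff.1 hwf
  have hx : ∀ x ∈ copyVerts f, x ∉ copyVerts e → x = w := fun x hxf hxe => by
    have : x ∈ copyVerts f \ copyVerts e := Finset.mem_sdiff.2 ⟨hxf, hxe⟩
    simpa [hw] using this
  refine ⟨w, hwf, hwe, hx, fun q hq => ?_⟩
  -- `e q` has five neighbours in either copy; having lost `e v`, it must gain `w`.
  by_contra hqw
  have hqf : e q ∈ copyVerts f := by
    by_contra hqf
    exact hq.ne (copy_missing_unique hdeg e f h hv hqf)
  obtain ⟨q', hq'⟩ := mem_copyVerts.1 hqf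
  have h3 := card_filter_adj_copyVerts f q'
  rw [hq'] at h3
  have h4 : (copyVerts f).filter (G.Adj (e q)) ⊆
      ((copyVerts e).filter (G.Adj (e q))).erase (e v) := by
    intro x hx'
    obtain ⟨hxf, hqx⟩ := Finset.mem_filter.1 hx'
    refine Finset.mem_erase.2 ⟨fun h => hv (h ▸ hxf), Finset.mem_filter.2 ⟨?_, hqx⟩⟩
    by_contra hxe
    exact hqw (hx x hxf hxe ▸ hqx)
  have h5 := Finset.card_le_card h4
  rw [Finset.card_erase_of_mem (Finset.mem_filter.2
    ⟨apply_mem_copyVerts e v, e.map_adj_iff.2 hq.symm⟩), card_filter_adj_copyVerts] at h5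
  omega

end LocalStructure

/-! ### Reducible configurations and the hitting set. -/

section Hitting

variable {V : Type*} [Fintype V] [DecidableEq V] {G : SimpleGraph V} [DecidableRel G.Adj]

/-- The vertex sets to be hit: 5-cliques and vertex sets of induced copies of `C5K2`. -/
def IsObstruction (G : SimpleGraph V) (X : Finset V) : Prop :=
  G.IsNClique 5 X ∨ ∃ e : C5K2 ↪g G, X = copyVerts e

/-- `J` is independent, hits some member of `F`, and has no neighbour in those members of `F` that
it does not hit. -/
structure IsFree (G : SimpleGraph V) (F : Finset (Finset V)) (J : Finset V) : Prop where
  indep : G.IsIndepSet (J : Set V)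
  covered : ∀ x ∈ J, ∃ X ∈ F, x ∈ X
  nonempty : J.Nonempty
  not_adj : ∀ x ∈ J, ∀ X ∈ F, (∀ z ∈ J, z ∉ X) → ∀ y ∈ X, ¬ G.Adj x y

theorem isFree_singleton {F : Finset (Finset V)} {x : V} (hx : ∃ X ∈ F, x ∈ X)
    (h : ∀ X ∈ F, x ∉ X → ∀ y ∈ X, ¬ G.Adj x y) : IsFree G F {x} where
  indep := by simp [SimpleGraph.IsIndepSet]
  covered := by simpa using hx
  nonempty := by simp
  not_adj := by simpa using h

theorem four_le_card_filter_adj {X : Finset V} (hX : IsObstruction G X) {v : V} (hv : v ∈ X) :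
    4 ≤ (X.filter (G.Adj v)).card := by
  rcases hX with hX | ⟨e, rfl⟩
  · have := card_filter_adj_clique hX hv
    omega
  · obtain ⟨p, rfl⟩ := mem_copyVerts.1 hv
    rw [card_filter_adj_copyVerts]
    omega

/-- `e` has a vertex outside of it that is adjacent to the columns `i` and `i + 1`. -/
def HasApex (e : C5K2 ↪g G) (i : Fin 5) : Prop :=
  ∃ w, w ∉ copyVerts e ∧ ∀ p : Fin 5 × Fin 2, p.1 = i ∨ p.1 = i + 1 → G.Adj (e p) w

/-- If `y` is outside the copy, it is the apex, being the only outside neighbour of `e p`. It then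
has 4 neighbours in the copy and 4 in `X`, but at most 6 in all, so the two sets share one. -/
theorem HasApex.meets (hdeg : ∀ v, G.degree v ≤ 6) {e : C5K2 ↪g G} {i : Fin 5}
    (hi : HasApex e i) {p : Fin 5 × Fin 2} (hp : p.1 = i ∨ p.1 = i + 1) {X : Finset V}
    (hX : IsObstruction G X) {y : V} (hy : y ∈ X) (hpy : G.Adj (e p) y) :
    (X ∩ copyVerts e).Nonempty := by
  by_cases hyS : y ∈ copyVerts e
  · exact ⟨y, Finset.mem_inter.2 ⟨hy, hyS⟩⟩
  obtain ⟨w, hw, hadj⟩ := hi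
  obtain rfl := outside_neighbor_unique hdeg e hyS hw hpy (hadj p hp)
  have h1 := four_le_card_filter_adj hX hy
  have h2 : ((Finset.univ.filter fun p : Fin 5 × Fin 2 => p.1 = i ∨ p.1 = i + 1).map
      e.toEmbedding) ⊆ (copyVerts e).filter (G.Adj y) := by
    intro x hx
    obtain ⟨q, hq, rfl⟩ := Finset.mem_map.1 hx
    exact Finset.mem_filter.2 ⟨apply_mem_copyVerts e q, (hadj q (by simpa using hq)).symm⟩
  have h3 := Finset.card_le_card h2
  have h4 : ∀ i : Fin 5, (Finset.univ.filter fun p : Fin 5 × Fin 2 =>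
      p.1 = i ∨ p.1 = i + 1).card = 4 := by decide
  rw [Finset.card_map, h4] at h3
  have h5 := card_filter_adj_inter hdeg y X (copyVerts e)
  have h6 : 0 < ((X ∩ copyVerts e).filter (G.Adj y)).card := by omega
  exact (Finset.card_pos.1 h6).mono (Finset.filter_subset _ _)

/-- Consecutive apexes share a neighbour in the copy, so they coincide; a single apex for three
column pairs would have 8 neighbours. -/
theorem not_hasApex_three (hdeg : ∀ v, G.degree v ≤ 6) (e : C5K2 ↪g G) (i : Fin 5) :
    ¬ (HasApex e i ∧ HasApex e (i + 1) ∧ HasApex e (i + 2)) := by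
  rintro ⟨⟨w, hw, h⟩, ⟨w', hw', h'⟩, ⟨w'', hw'', h''⟩⟩
  have i2 : i + 1 + 1 = i + 2 := by rw [add_assoc]; rfl
  obtain rfl := outside_neighbor_unique hdeg e hw hw' (h (i + 1, 0) (Or.inr rfl))
    (h' (i + 1, 0) (Or.inl rfl))
  obtain rfl := outside_neighbor_unique hdeg e hw hw'' (h' (i + 2, 0) (Or.inr i2.symm))
    (h'' (i + 2, 0) (Or.inl rfl))
  have h1 := card_le_of_adj_copy hdeg e (w := w) (Finset.univ.filter fun p : Fin 5 × Fin 2 =>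
    (p.1 = i ∨ p.1 = i + 1) ∨ (p.1 = i + 2 ∨ p.1 = i + 2 + 1)) (by
      intro p hp
      rcases (Finset.mem_filter.1 hp).2 with hp | hp
      · exact h p hp
      · exact h'' p hp)
  have h2 : ∀ i : Fin 5, (Finset.univ.filter fun p : Fin 5 × Fin 2 =>
    (p.1 = i ∨ p.1 = i + 1) ∨ (p.1 = i + 2 ∨ p.1 = i + 2 + 1)).card = 8 := by decide
  rw [h2] at h1
  omega

/-- `J` is one vertex of the copy, or two from non-adjacent columns, chosen in columns covered by
apexes. Any member with a neighbour of `J` then meets the copy, and the choice of columns forces it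
to be hit. -/
theorem exists_isFree_of_clique_meets_copy (hdeg : ∀ v, G.degree v ≤ 6)
    {F : Finset (Finset V)} (hF : ∀ X ∈ F, IsObstruction G X) (e : C5K2 ↪g G)
    (he : copyVerts e ∈ F) {A : Finset V} (hA : G.IsNClique 5 A)
    (hAe : (A ∩ copyVerts e).Nonempty) : ∃ J, IsFree G F J := by
  classical
  have hclique : ∀ B : Finset V, G.IsNClique 5 B → (B ∩ copyVerts e).Nonempty →
      ∃ j, HasApex e j ∧ ∀ p : Fin 5 × Fin 2, p.1 = j ∨ p.1 = j + 1 → e p ∈ B := by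
    intro B hB hBe
    obtain ⟨-, j, w, -, hw, hj, hadj, -⟩ := clique_meets_copy hdeg e hB hBe
    exact ⟨j, ⟨w, hw, hadj⟩, fun p hp => (hj p).2 hp⟩
  -- Columns `i` and `i + 2` meet every pair of consecutive columns except that starting at `i + 3`,
  -- so they hit all cliques meeting the copy when that pair has no apex.
  have choice : ∀ E : Fin 5 → Bool, (∃ i, E i = true) →
      (∀ i, ¬ (E i = true ∧ E (i + 1) = true ∧ E (i + 2) = true)) →
      (∃ i, E i = true ∧ ∀ j, E j = true → j = i) ∨
      ∃ i, (E i = true ∨ E (i + 4) = true) ∧ (E (i + 2) = true ∨ E (i + 1) = true) ∧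
        ¬ E (i + 3) = true := by decide
  have hch := choice (fun i => decide (HasApex e i))
    (by obtain ⟨j, hj, -⟩ := hclique A hA hAe; exact ⟨j, by simpa using hj⟩)
    (fun i => by simpa using not_hasApex_three hdeg e i)
  simp only [decide_eq_true_eq] at hch
  rcases hch with ⟨i, hi, huniq⟩ | ⟨i, hi, hi2, hi3⟩
  · refine ⟨{e (i, 0)}, isFree_singleton ⟨_, he, apply_mem_copyVerts e _⟩ ?_⟩
    intro X hX hiX y hy hiy
    have hm := hi.meets hdeg (p := (i, 0)) (Or.inl rfl) (hF X hX) hy hiy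
    rcases hF X hX with hXc | ⟨f, rfl⟩
    · obtain ⟨j, hj, hjX⟩ := hclique X hXc hm
      obtain rfl := huniq j hj
      exact hiX (hjX _ (Or.inl rfl))
    · rw [Finset.inter_comm] at hm
      obtain ⟨w', -, hw', -, hadj'⟩ := copy_meets_copy hdeg e f hm hiX
      obtain ⟨w, hw, hadj⟩ := hi
      have d1 : ∀ i : Fin 5, C5K2.Adj (i, 0) (i, 1) := by decide
      have d2 : ∀ i : Fin 5, ∀ p : Fin 5 × Fin 2, p.1 = i + 4 → C5K2.Adj (i, 0) p := by decide
      have d3 : ∀ i : Fin 5, i + 4 + 1 = i ∧ i + 4 ≠ i := by decide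
      obtain rfl := outside_neighbor_unique hdeg e hw hw' (hadj (i, 1) (Or.inl rfl))
        (hadj' (i, 1) (d1 i))
      -- The twin replacing `e (i, 0)` in `f` is the apex `w`, which is thus also an apex for the
      -- preceding pair.
      refine (d3 i).2 (huniq (i + 4) ⟨w, hw, fun p hp => ?_⟩)
      rcases hp with hp | hp
      · exact hadj' p (d2 i p hp)
      · exact hadj p (Or.inl (hp.trans (d3 i).1))
  · have d1 : ∀ i : Fin 5, ¬ C5K2.Adj (i, 0) (i + 2, 0) := by decide
    have d2 : ∀ i : Fin 5, i = i + 4 + 1 ∧ i + 2 = i + 1 + 1 := by decide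
    have d3 : ∀ i j : Fin 5, j ≠ i + 3 →
        (i = j ∨ i = j + 1) ∨ (i + 2 = j ∨ i + 2 = j + 1) := by decide
    have hm : ∀ X ∈ F, ∀ y ∈ X, (G.Adj (e (i, 0)) y ∨ G.Adj (e (i + 2, 0)) y) →
        (X ∩ copyVerts e).Nonempty := by
      rintro X hX y hy (h | h)
      · rcases hi with hi | hi
        · exact hi.meets hdeg (p := (i, 0)) (Or.inl rfl) (hF X hX) hy h
        · exact hi.meets hdeg (p := (i, 0)) (Or.inr (d2 i).1) (hF X hX) hy h
      · rcases hi2 with hi | hi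
        · exact hi.meets hdeg (p := (i + 2, 0)) (Or.inl rfl) (hF X hX) hy h
        · exact hi.meets hdeg (p := (i + 2, 0)) (Or.inr (d2 i).2) (hF X hX) hy h
    have hhit : ∀ X ∈ F, (X ∩ copyVerts e).Nonempty → e (i, 0) ∉ X → e (i + 2, 0) ∉ X →
        False := by
      intro X hX hXe h0 h2
      rcases hF X hX with hXc | ⟨f, rfl⟩
      · obtain ⟨j, hj, hjX⟩ := hclique X hXc hXe
        rcases d3 i j (fun h => hi3 (h ▸ hj)) with h | h
        · exact h0 (hjX _ h)
        · exact h2 (hjX _ h)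
      · rw [Finset.inter_comm] at hXe
        have := copy_missing_unique hdeg e f hXe h0 h2
        simp at this
    refine ⟨{e (i, 0), e (i + 2, 0)}, ?_, ?_, by simp, ?_⟩
    · have hn : ¬ G.Adj (e (i, 0)) (e (i + 2, 0)) := fun h => d1 i (e.map_adj_iff.1 h)
      intro x hx y hy hxy
      simp only [Finset.coe_insert, Finset.coe_singleton, Set.mem_insert_iff,
        Set.mem_singleton_iff] at hx hy
      rcases hx with rfl | rfl <;> rcases hy with rfl | rfl
      · exact absurd rfl hxy
      · exact hn
      · exact fun h => hn h.symm
      · exact absurd rfl hxy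
    · intro x hx
      refine ⟨_, he, ?_⟩
      simp only [Finset.mem_insert, Finset.mem_singleton] at hx
      rcases hx with rfl | rfl <;> exact apply_mem_copyVerts e _
    · intro x hx X hX hJ y hy hxy
      have h0 := hJ (e (i, 0)) (by simp)
      have h2 := hJ (e (i + 2, 0)) (by simp)
      simp only [Finset.mem_insert, Finset.mem_singleton] at hx
      refine hhit X hX (hm X hX y hy ?_) h0 h2
      rcases hx with rfl | rfl
      · exact Or.inl hxy
      · exact Or.inr hxy

/-- With `f` obtained from `e` by exchanging `e v` for `w`, a vertex in the column after that of `v`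
has all its neighbours in the two copies. A further copy avoiding it would make `w` its twin as
well, giving `w` too many neighbours. -/
theorem exists_isFree_of_copies_meet (hdeg : ∀ v, G.degree v ≤ 6)
    {F : Finset (Finset V)} (hF : ∀ X ∈ F, IsObstruction G X)
    (hsep : ∀ e : C5K2 ↪g G, copyVerts e ∈ F → ∀ A, G.IsNClique 5 A →
      ¬ (A ∩ copyVerts e).Nonempty)
    (e f : C5K2 ↪g G) (he : copyVerts e ∈ F) (hf : copyVerts f ∈ F)
    (hne : copyVerts e ≠ copyVerts f) (hef : (copyVerts e ∩ copyVerts f).Nonempty) :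
    ∃ J, IsFree G F J := by
  obtain ⟨v, hv⟩ : ∃ v, e v ∉ copyVerts f := by
    by_contra! hc
    refine hne (Finset.eq_of_subset_of_card_le (fun x hx => ?_) ?_)
    · obtain ⟨p, rfl⟩ := mem_copyVerts.1 hx
      exact hc p
    · rw [card_copyVerts, card_copyVerts]
  obtain ⟨w, hwf, hwe, hw, hadj⟩ := copy_meets_copy hdeg e f hef hv
  have d1 : ∀ v : Fin 5 × Fin 2, C5K2.Adj v (v.1 + 1, 0) ∧ C5K2.Adj v (v.1 + 1, 1) ∧
      C5K2.Adj (v.1 + 1, 0) (v.1 + 1, 1) := by decide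
  obtain ⟨hv0, hv1, h01⟩ := d1 v
  have hmem : ∀ q, C5K2.Adj v q → e q ∈ copyVerts f := by
    intro q hq
    by_contra hqf
    exact hq.ne (copy_missing_unique hdeg e f hef hv hqf)
  refine ⟨{e (v.1 + 1, 0)}, isFree_singleton ⟨_, he, apply_mem_copyVerts e _⟩ ?_⟩
  intro X hX hqX y hy hqy
  have hyef : y ∈ copyVerts e ∨ y ∈ copyVerts f := by
    by_cases h : y ∈ copyVerts e
    · exact Or.inl h
    · right
      rw [outside_neighbor_unique hdeg e h hwe hqy (hadj _ hv0)]
      exact hwf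
  rcases hF X hX with hXc | ⟨g, rfl⟩
  · rcases hyef with h | h
    · exact hsep e he X hXc ⟨y, Finset.mem_inter.2 ⟨hy, h⟩⟩
    · exact hsep f hf X hXc ⟨y, Finset.mem_inter.2 ⟨hy, h⟩⟩
  · have heg : (copyVerts e ∩ copyVerts g).Nonempty := by
      rcases hyef with h | h
      · exact ⟨y, Finset.mem_inter.2 ⟨h, hy⟩⟩
      · have hfg : (copyVerts f ∩ copyVerts g).Nonempty := ⟨y, Finset.mem_inter.2 ⟨h, hy⟩⟩
        refine ⟨e (v.1 + 1, 1), Finset.mem_inter.2 ⟨apply_mem_copyVerts e _, ?_⟩⟩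
        by_contra hc
        obtain ⟨a, ha⟩ := mem_copyVerts.1 (hmem _ hv0)
        obtain ⟨b, hb⟩ := mem_copyVerts.1 (hmem _ hv1)
        have hab := copy_missing_unique hdeg f g hfg (ha ▸ hqX) (hb ▸ hc)
        have := e.injective (ha.symm.trans ((congrArg f hab).trans hb))
        simp at this
    obtain ⟨w', -, hwe', -, hadj'⟩ := copy_meets_copy hdeg e g heg hqX
    obtain rfl := outside_neighbor_unique hdeg e hwe hwe' (hadj _ hv1) (hadj' _ h01)
    have h1 := card_le_of_adj_copy hdeg e (w := w)
      (Finset.univ.filter fun p => C5K2.Adj v p ∨ C5K2.Adj (v.1 + 1, 0) p) (by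
        intro p hp
        rcases (Finset.mem_filter.1 hp).2 with hp | hp
        · exact hadj p hp
        · exact hadj' p hp)
    have h2 : ∀ v : Fin 5 × Fin 2, 7 ≤ (Finset.univ.filter fun p =>
      C5K2.Adj v p ∨ C5K2.Adj (v.1 + 1, 0) p).card := by decide
    exact absurd (h2 v) (by omega)

/-- The union has 7 vertices, so each common vertex has the rest of the union as its whole
neighbourhood, and any one of them is free. -/
theorem exists_isFree_of_cliques_meet (hdeg : ∀ v, G.degree v ≤ 6) (hfree : G.CliqueFree 6)
    {F : Finset (Finset V)} (hF : ∀ X ∈ F, IsObstruction G X)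
    (hsep : ∀ e : C5K2 ↪g G, copyVerts e ∈ F → ∀ A, G.IsNClique 5 A →
      ¬ (A ∩ copyVerts e).Nonempty)
    {A B : Finset V} (hAF : A ∈ F) (hA : G.IsNClique 5 A) (hB : G.IsNClique 5 B)
    (hAB : (A ∩ B).Nonempty) (hcard : (A ∩ B).card ≤ 3) : ∃ J, IsFree G F J := by
  have h3 := three_le_card_inter_cliques hdeg hA hB hAB
  have hunion : (A ∪ B).card = 7 := by
    have := Finset.card_union_add_card_inter A B
    rw [hA.2, hB.2] at this
    omega
  have hN : ∀ d ∈ A ∩ B, ∀ y, G.Adj d y → y ∈ A ∪ B := by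
    intro d hd y hdy
    obtain ⟨hdA, hdB⟩ := Finset.mem_inter.1 hd
    have hsub : (A ∪ B).erase d ⊆ G.neighborFinset d := by
      intro x hx
      obtain ⟨hxd, hx⟩ := Finset.mem_erase.1 hx
      rw [SimpleGraph.mem_neighborFinset]
      rcases Finset.mem_union.1 hx with h | h
      · exact hA.1 hdA h hxd.symm
      · exact hB.1 hdB h hxd.symm
    have heq := Finset.eq_of_subset_of_card_le hsub (by
      rw [Finset.card_erase_of_mem (Finset.mem_union_left _ hdA), hunion,
        SimpleGraph.card_neighborFinset_eq_degree]
      exact hdeg d)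
    have : y ∈ (A ∪ B).erase d := by rw [heq]; simpa using hdy
    exact (Finset.mem_erase.1 this).2
  obtain ⟨d, hd⟩ := hAB
  obtain ⟨hdA, hdB⟩ := Finset.mem_inter.1 hd
  refine ⟨{d}, isFree_singleton ⟨A, hAF, hdA⟩ ?_⟩
  intro X hX hdX y hy hdy
  have key : ∀ C : Finset V, G.IsNClique 5 C → A ∩ B ⊆ C → C ⊆ A ∪ B → y ∈ C → False := by
    intro C hC hABC hCAB hyC
    have hXC : (X ∩ C).Nonempty := ⟨y, Finset.mem_inter.2 ⟨hy, hyC⟩⟩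
    rcases hF X hX with hXc | ⟨g, rfl⟩
    · have h1 := three_le_card_inter_cliques hdeg hXc hC hXC
      have h2 := Finset.card_union_add_card_inter (X ∩ C) (A ∩ B)
      have h4 := Finset.card_le_card
        (Finset.union_subset (Finset.inter_subset_right : X ∩ C ⊆ C) hABC)
      rw [hC.2] at h4
      -- Two subsets of size at least 3 in a 5-set meet. All of `X` then lies in the closed
      -- neighbourhood of `d'`, which is also that of `d`, so adding `d` gives a 6-clique.
      obtain ⟨d', hd'⟩ : (X ∩ C ∩ (A ∩ B)).Nonempty := by
        rw [← Finset.card_pos]; omega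
      obtain ⟨hd'X, hd'AB⟩ := Finset.mem_inter.1 hd'
      have hd'X := (Finset.mem_inter.1 hd'X).1
      refine hfree _ (hXc.insert (a := d) fun x hx => ?_)
      have hxd : d ≠ x := fun h => hdX (h ▸ hx)
      have hxAB : x ∈ A ∪ B := by
        by_cases h : d' = x
        · exact h ▸ Finset.mem_union_left _ (Finset.mem_inter.1 hd'AB).1
        · exact hN d' hd'AB x (hXc.1 hd'X hx h)
      rcases Finset.mem_union.1 hxAB with h | h
      · exact hA.1 hdA h hxd
      · exact hB.1 hdB h hxd
    · exact hsep g hX C hC (by rwa [Finset.inter_comm])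
  rcases Finset.mem_union.1 (hN d hd y hdy) with h | h
  · exact key A hA Finset.inter_subset_left Finset.subset_union_left h
  · exact key B hB Finset.inter_subset_right Finset.subset_union_right h

/-- Three pairwise intersecting 5-cliques with large intersections. -/
theorem inter_subset_of_cliques (hfree : G.CliqueFree 6) {X Y Z : Finset V}
    (hX : G.IsNClique 5 X) (hY : G.IsNClique 5 Y) (hZ : G.IsNClique 5 Z)
    (hXY : 4 = (X ∩ Y).card) (hXZ : 4 ≤ (X ∩ Z).card) (hYZ : 4 ≤ (Y ∩ Z).card) :
    X ∩ Y ⊆ Z := by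
  intro v hv
  by_contra hvZ
  obtain ⟨hvX, hvY⟩ := Finset.mem_inter.1 hv
  have hZX : X ∩ Z = X.erase v := Finset.eq_of_subset_of_card_le
    (fun x hx => Finset.mem_erase.2 ⟨fun h => hvZ (h ▸ (Finset.mem_inter.1 hx).2),
      (Finset.mem_inter.1 hx).1⟩) (by rw [Finset.card_erase_of_mem hvX, hX.2]; exact hXZ)
  have hZY : Y ∩ Z = Y.erase v := Finset.eq_of_subset_of_card_le
    (fun x hx => Finset.mem_erase.2 ⟨fun h => hvZ (h ▸ (Finset.mem_inter.1 hx).2),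
      (Finset.mem_inter.1 hx).1⟩) (by rw [Finset.card_erase_of_mem hvY, hY.2]; exact hYZ)
  -- `y` is adjacent to `v` within `Y` and to the rest of `X` within `Z`, so it extends `X` to a
  -- 6-clique.
  obtain ⟨y, hyY, hyX⟩ : ∃ y ∈ Y, y ∉ X := by
    by_contra! hc
    have : X ∩ Y = Y := Finset.inter_eq_right.2 hc
    rw [this, hY.2] at hXY
    omega
  have hyv : y ≠ v := fun h => hyX (h ▸ hvX)
  have hyZ : y ∈ Z := by
    have : y ∈ Y ∩ Z := by rw [hZY]; exact Finset.mem_erase.2 ⟨hyv, hyY⟩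
    exact (Finset.mem_inter.1 this).2
  refine hfree _ (hX.insert (a := y) fun x hx => ?_)
  have hyx : y ≠ x := fun h => hyX (h ▸ hx)
  by_cases hxv : x = v
  · exact hxv ▸ hY.1 hyY hvY hyv
  · have : x ∈ X ∩ Z := by rw [hZX]; exact Finset.mem_erase.2 ⟨hxv, hx⟩
    exact hZ.1 hyZ (Finset.mem_inter.1 this).2 hyx

/-- Hitting a family in which cliques and copies are disjoint, distinct copies are disjoint, and
intersecting cliques share four vertices. -/
theorem exists_hitting_of_separated [Nonempty V] (hdeg : ∀ v, G.degree v ≤ 6)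
    (hfree : G.CliqueFree 6)
    {F : Finset (Finset V)} (hF : ∀ X ∈ F, IsObstruction G X)
    (hsep : ∀ e : C5K2 ↪g G, copyVerts e ∈ F → ∀ A, G.IsNClique 5 A →
      ¬ (A ∩ copyVerts e).Nonempty)
    (hcopy : ∀ e f : C5K2 ↪g G, copyVerts e ∈ F → copyVerts f ∈ F →
      (copyVerts e ∩ copyVerts f).Nonempty → copyVerts e = copyVerts f)
    (hclique : ∀ A ∈ F, ∀ B ∈ F, G.IsNClique 5 A → G.IsNClique 5 B → (A ∩ B).Nonempty →
      4 ≤ (A ∩ B).card) :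
    ∃ I : Finset V, G.IsIndepSet (I : Set V) ∧ (∀ x ∈ I, ∃ X ∈ F, x ∈ X) ∧
      ∀ X ∈ F, ∃ x ∈ I, x ∈ X := by
  classical
  have hmeet : ∀ X ∈ F, ∀ Y ∈ F, (X ∩ Y).Nonempty →
      X = Y ∨ (G.IsNClique 5 X ∧ G.IsNClique 5 Y ∧ 4 ≤ (X ∩ Y).card) := by
    intro X hX Y hY h
    rcases hF X hX with hXc | ⟨e, rfl⟩ <;> rcases hF Y hY with hYc | ⟨f, rfl⟩
    · exact Or.inr ⟨hXc, hYc, hclique X hX Y hY hXc hYc h⟩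
    · exact absurd h (hsep f hY X hXc)
    · exact absurd (by rwa [Finset.inter_comm]) (hsep e hX Y hYc)
    · exact Or.inl (hcopy e f hX hY h)
  -- Two 4-subsets of a 5-clique intersect.
  have htrans : ∀ X ∈ F, ∀ Y ∈ F, ∀ Z ∈ F, (X ∩ Y).Nonempty → (Y ∩ Z).Nonempty →
      (X ∩ Z).Nonempty := by
    intro X hX Y hY Z hZ hXY hYZ
    rcases hmeet X hX Y hY hXY with rfl | ⟨hXc, hYc, h1⟩
    · exact hYZ
    rcases hmeet Y hY Z hZ hYZ with rfl | ⟨-, hZc, h2⟩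
    · exact hXY
    have h3 := Finset.card_union_add_card_inter (X ∩ Y) (Y ∩ Z)
    have h4 := Finset.card_le_card (Finset.union_subset
      (Finset.inter_subset_right : X ∩ Y ⊆ Y) (Finset.inter_subset_left : Y ∩ Z ⊆ Y))
    rw [hYc.2] at h4
    obtain ⟨v, hv⟩ : (X ∩ Y ∩ (Y ∩ Z)).Nonempty := by
      rw [← Finset.card_pos]; omega
    simp only [Finset.mem_inter] at hv
    exact ⟨v, Finset.mem_inter.2 ⟨hv.1.1, hv.2.2⟩⟩
  -- The core of the class of `X`: the vertices common to all members meeting `X`.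
  let D : Finset V → Finset V := fun X => X.filter fun v => ∀ Y ∈ F, (Y ∩ X).Nonempty → v ∈ Y
  have hDX : ∀ X, D X ⊆ X := fun X => Finset.filter_subset _ _
  have hDsub : ∀ X ∈ F, ∀ Y ∈ F, (X ∩ Y).Nonempty → D X ⊆ D Y := by
    intro X hX Y hY h v hv
    obtain ⟨-, hv⟩ := Finset.mem_filter.1 hv
    refine Finset.mem_filter.2 ⟨hv Y hY (by rwa [Finset.inter_comm]), fun Z hZ hZY => ?_⟩
    exact hv Z hZ (htrans Z hZ Y hY X hX hZY (by rwa [Finset.inter_comm]))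
  have hDeq : ∀ X ∈ F, ∀ Y ∈ F, (X ∩ Y).Nonempty → D X = D Y := fun X hX Y hY h =>
    (hDsub X hX Y hY h).antisymm (hDsub Y hY X hX (by rwa [Finset.inter_comm]))
  have hDcard : ∀ X ∈ F, 4 ≤ (D X).card := by
    intro X hX
    have hX4 : 4 ≤ X.card := by
      rcases hF X hX with h | ⟨e, rfl⟩
      · rw [h.2]; omega
      · rw [card_copyVerts]; omega
    by_cases hall : ∀ Y ∈ F, (Y ∩ X).Nonempty → Y = X
    · have : D X = X := Finset.filter_true_of_mem fun v hv Y hY h => hall Y hY h ▸ hv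
      rw [this]; exact hX4
    push Not at hall
    obtain ⟨Y, hY, hYX, hne⟩ := hall
    obtain ⟨hYc, hXc, h4⟩ := (hmeet Y hY X hX hYX).resolve_left hne
    rw [Finset.inter_comm] at h4
    have h5 : (X ∩ Y).card ≤ 4 := by
      by_contra hc
      have h6 : X ∩ Y = X :=
        Finset.eq_of_subset_of_card_le Finset.inter_subset_left (by rw [hXc.2]; omega)
      have h7 : X ∩ Y = Y :=
        Finset.eq_of_subset_of_card_le Finset.inter_subset_right (by rw [hYc.2]; omega)
      exact hne (h7.symm.trans h6)
    refine h4.trans (Finset.card_le_card fun v hv => Finset.mem_filter.2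
      ⟨(Finset.mem_inter.1 hv).1, fun Z hZ hZX => ?_⟩)
    rcases hmeet Z hZ X hX hZX with rfl | ⟨hZc, -, h8⟩
    · exact (Finset.mem_inter.1 hv).1
    have h9 := htrans Z hZ X hX Y hY hZX (by rwa [Finset.inter_comm])
    have h10 := hclique Z hZ Y hY hZc hYc h9
    exact inter_subset_of_cliques hfree hXc hYc hZc (le_antisymm h4 h5)
      (by rwa [Finset.inter_comm]) (by rwa [Finset.inter_comm]) hv
  -- Edges within a core are dropped: only one vertex is chosen there, and they would spoil the
  -- degree bound.
  let H : SimpleGraph V :=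
    { Adj := fun u v => G.Adj u v ∧ ∃ X ∈ F, ∃ Y ∈ F, u ∈ D X ∧ v ∈ D Y ∧ D X ≠ D Y
      symm := ⟨by
        rintro u v ⟨h, X, hX, Y, hY, hu, hv, hne⟩
        exact ⟨h.symm, Y, hY, X, hX, hv, hu, hne.symm⟩⟩
      loopless := ⟨fun u h => G.irrefl h.1⟩ }
  have hHdeg : ∀ v, H.degree v ≤ 2 := by
    intro v
    by_cases hv : ∃ X ∈ F, v ∈ D X
    · obtain ⟨X, hX, hvX⟩ := hv
      have h1 : H.neighborFinset v ⊆ G.neighborFinset v \ X.filter (G.Adj v) := by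
        intro u hu
        rw [SimpleGraph.mem_neighborFinset] at hu
        obtain ⟨hvu, X', hX', Y, hY, hvX', huY, hne⟩ := hu
        refine Finset.mem_sdiff.2 ⟨by simpa using hvu, fun huX => hne ?_⟩
        have h2 := hDeq X hX X' hX' ⟨v, Finset.mem_inter.2 ⟨hDX X hvX, hDX X' hvX'⟩⟩
        have h3 := hDeq X hX Y hY
          ⟨u, Finset.mem_inter.2 ⟨(Finset.mem_filter.1 huX).1, hDX Y huY⟩⟩
        exact h2.symm.trans h3
      have h2 := Finset.card_le_card h1
      rw [Finset.card_sdiff_of_subset (fun u hu => by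
        simpa using (Finset.mem_filter.1 hu).2), SimpleGraph.card_neighborFinset_eq_degree,
        SimpleGraph.card_neighborFinset_eq_degree] at h2
      have h3 := hdeg v
      have h4 := four_le_card_filter_adj (hF X hX) (hDX X hvX)
      omega
    · have : H.neighborFinset v = ∅ := by
        rw [Finset.eq_empty_iff_forall_notMem]
        intro u hu
        rw [SimpleGraph.mem_neighborFinset] at hu
        obtain ⟨-, X, hX, -, -, hvX, -⟩ := hu
        exact hv ⟨X, hX, hvX⟩
      rw [← SimpleGraph.card_neighborFinset_eq_degree, this]
      simp
  obtain ⟨t, ht, ht'⟩ := exists_transversal H (d := 2) (by norm_num) hHdeg id (F.image D)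
    (by
      intro P hP Q hQ hne
      obtain ⟨X, hX, rfl⟩ := Finset.mem_image.1 hP
      obtain ⟨Y, hY, rfl⟩ := Finset.mem_image.1 hQ
      refine Finset.disjoint_left.2 fun v hvX hvY => hne ?_
      exact hDeq X hX Y hY ⟨v, Finset.mem_inter.2 ⟨hDX X hvX, hDX Y hvY⟩⟩)
    (by
      intro P hP
      obtain ⟨X, hX, rfl⟩ := Finset.mem_image.1 hP
      exact hDcard X hX)
  have htD : ∀ X ∈ F, t (D X) ∈ D X := fun X hX => by
    simpa using ht (D X) (Finset.mem_image_of_mem _ hX)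
  refine ⟨F.image fun X => t (D X), ?_, ?_, ?_⟩
  · intro x hx y hy hxy hadj
    simp only [Finset.coe_image, Set.mem_image, Finset.mem_coe] at hx hy
    obtain ⟨X, hX, rfl⟩ := hx
    obtain ⟨Y, hY, rfl⟩ := hy
    exact ht' _ (Finset.mem_image_of_mem _ hX) _ (Finset.mem_image_of_mem _ hY)
      ⟨hadj, X, hX, Y, hY, htD X hX, htD Y hY, fun h => hxy (by rw [h])⟩
  · intro x hx
    obtain ⟨X, hX, rfl⟩ := Finset.mem_image.1 hx
    exact ⟨X, hX, hDX X (htD X hX)⟩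
  · intro X hX
    exact ⟨_, Finset.mem_image_of_mem _ hX, hDX X (htD X hX)⟩

theorem exists_hitting [Nonempty V] (hdeg : ∀ v, G.degree v ≤ 6) (hfree : G.CliqueFree 6)
    (F : Finset (Finset V)) (hF : ∀ X ∈ F, IsObstruction G X) :
    ∃ I : Finset V, G.IsIndepSet (I : Set V) ∧ (∀ x ∈ I, ∃ X ∈ F, x ∈ X) ∧
      ∀ X ∈ F, ∃ x ∈ I, x ∈ X := by
  classical
  induction F using Finset.strongInduction with
  | H F ih =>
  by_cases hJ : ∃ J, IsFree G F J
  · obtain ⟨J, hJ⟩ := hJ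
    have hss : F.filter (fun X => ∀ z ∈ J, z ∉ X) ⊂ F := by
      obtain ⟨x, hx⟩ := hJ.nonempty
      obtain ⟨X, hX, hxX⟩ := hJ.covered x hx
      exact Finset.filter_ssubset.2 ⟨X, hX, fun h => h x hx hxX⟩
    obtain ⟨I, hI, hIcov, hIhit⟩ := ih _ hss fun X hX => hF X (Finset.mem_filter.1 hX).1
    -- This is why the induction also demands that every chosen vertex lie in a member of the
    -- family.
    have hIJ : ∀ x ∈ J, ∀ y ∈ I, ¬ G.Adj x y := by
      intro x hx y hy
      obtain ⟨X, hX, hyX⟩ := hIcov y hy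
      obtain ⟨hX, hXJ⟩ := Finset.mem_filter.1 hX
      exact hJ.not_adj x hx X hX hXJ y hyX
    refine ⟨I ∪ J, ?_, ?_, ?_⟩
    · intro x hx y hy hxy
      rcases Finset.mem_union.1 hx with hx | hx <;> rcases Finset.mem_union.1 hy with hy | hy
      · exact hI hx hy hxy
      · exact fun h => hIJ y hy x hx h.symm
      · exact hIJ x hx y hy
      · exact hJ.indep hx hy hxy
    · intro x hx
      rcases Finset.mem_union.1 hx with hx | hx
      · obtain ⟨X, hX, hxX⟩ := hIcov x hx
        exact ⟨X, (Finset.mem_filter.1 hX).1, hxX⟩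
      · exact hJ.covered x hx
    · intro X hX
      by_cases h : ∀ z ∈ J, z ∉ X
      · obtain ⟨x, hx, hxX⟩ := hIhit X (Finset.mem_filter.2 ⟨hX, h⟩)
        exact ⟨x, Finset.mem_union_left _ hx, hxX⟩
      · push Not at h
        obtain ⟨x, hx, hxX⟩ := h
        exact ⟨x, Finset.mem_union_right _ hx, hxX⟩
  · have hsep : ∀ e : C5K2 ↪g G, copyVerts e ∈ F → ∀ A, G.IsNClique 5 A →
        ¬ (A ∩ copyVerts e).Nonempty := fun e he A hA h =>
      hJ (exists_isFree_of_clique_meets_copy hdeg hF e he hA h)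
    refine exists_hitting_of_separated hdeg hfree hF hsep ?_ ?_
    · intro e f he hf h
      by_contra hne
      exact hJ (exists_isFree_of_copies_meet hdeg hF hsep e f he hf hne h)
    · intro A hAF B _ hA hB h
      by_contra hc
      exact hJ (exists_isFree_of_cliques_meet hdeg hfree hF hsep hAF hA hB h (by omega))

end Hitting

/-! ### Passing from induced copies to obstructions. -/

theorem lemma5 {V : Type*} [Fintype V] (G : SimpleGraph V) [DecidableRel G.Adj]
    (hconn : G.Connected) (hΔ : G.maxDegree ≤ 6) (hω : G.cliqueNum ≤ 5) :
    ∃ I : Set V, G.IsIndepSet I ∧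
      MeetsInducedCopies G (SimpleGraph.completeGraph (Fin 5)) I ∧
      MeetsInducedCopies G
        (strongProduct (SimpleGraph.cycleGraph 5) (SimpleGraph.completeGraph (Fin 2))) I := by
  classical
  have : Nonempty V := hconn.nonempty
  obtain ⟨I, hI, -, hhit⟩ := exists_hitting (G := G) (fun v => (G.degree_le_maxDegree v).trans hΔ)
    (fun A hA => by
      have := hA.1.card_le_cliqueNum
      rw [hA.2] at this
      omega)
    (Finset.univ.filter (IsObstruction G)) (fun X hX => (Finset.mem_filter.1 hX).2)
  have hembed : ∀ {W : Type} [Fintype W] (K : SimpleGraph W) (S : Set V),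
      (G.induce S ≃g K) → ∃ f : K ↪g G, ∀ w, f w ∈ S := fun K S φ =>
    ⟨φ.symm.toEmbedding.trans (SimpleGraph.Embedding.induce S), fun w => (φ.symm w).2⟩
  refine ⟨I, hI, ?_, ?_⟩
  · rintro S ⟨φ⟩
    obtain ⟨f, hf⟩ := hembed _ S φ
    obtain ⟨x, hxI, hx⟩ := hhit (Finset.univ.map f.toEmbedding) (by
      refine Finset.mem_filter.2 ⟨Finset.mem_univ _, Or.inl ⟨?_, by simp⟩⟩
      intro x hx y hy hxy
      obtain ⟨a, -, rfl⟩ := Finset.mem_map.1 hx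
      obtain ⟨b, -, rfl⟩ := Finset.mem_map.1 hy
      exact f.map_adj_iff.2 fun h => hxy (by rw [h]))
    obtain ⟨a, -, rfl⟩ := Finset.mem_map.1 hx
    exact ⟨_, hxI, hf a⟩
  · rintro S ⟨φ⟩
    obtain ⟨f, hf⟩ := hembed _ S φ
    obtain ⟨x, hxI, hx⟩ := hhit (copyVerts f)
      (Finset.mem_filter.2 ⟨Finset.mem_univ _, Or.inr ⟨f, rfl⟩⟩)
    obtain ⟨a, rfl⟩ := mem_copyVerts.1 hx
    exact ⟨_, hxI, hf a⟩
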